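/- Notation. In $\mathbb{R}^d$ with the Euclidean norm, $\mathcal{B}(x,r)$ is the closed ball, $\partial$ the topological boundary, $d(x,A)=\inf_{a\in A}\|x-a\|$, $B(A,r)=\{x: d(x,A)\le r\}$, $\omega_d$ the volume of the unit ball and $d_H$ the Hausdorff distance. Let $\mathrm{Unp}(A)$ be the set of points with a unique nearest point in $A$. The reach of $A$ is $\inf_{x\in A}\sup\{r>0:\mathring{\mathcal{B}}(x,r)\subset \mathrm{Unp}(A)\}\in[0,\infty]$. Corollary. Let $\mathcal{M}\subset\mathbb{R}^d$ be a compact set with empty interior and with $R_0=\mathrm{reach}(\mathcal{M})>0$, and let $0<R_1<R_0$. Let $Y_1,Y_2,\dots$ be i.i.d. with a distribution $P_Y$ whose support is $S=B(\mathcal{M},R_1)$, which is absolutely continuous with respect to the Lebesgue measure and whose density is bounded from below on $S$ by a constant $f_0>0$ (almost everywhere). Let $\varepsilon_n=c\,(\log n/n)^{1/d}$ with $c>(6/(f_0\omega_d))^{1/d}$, and let $\lambda\in(0,1)$. For the sample $Y_1,\dots,Y_n$ let $\hat S_n=\bigcup_{i=1}^n\mathcal{B}(Y_i,\varepsilon_n)$;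 let $I_{bb}$ be the set of indices $j\le n$ such that $\mathcal{B}(Y_j,\varepsilon_n)$ is a boundary ball, i.e. $\partial\mathcal{B}(Y_j,\varepsilon_n)\cap\partial\hat S_n\neq\emptyset$; let $\hat A_n=\{Y_j: j\in I_{bb}\}$ (the estimator of $\partial S$) and $\hat R_n=\max_{i\le n}\min_{j\in I_{bb}}\|Y_i-Y_j\|$ (the estimator of $R_1$). Let $\pi(Y_i)$ be the metric projection of $Y_i$ on the finite set $\hat A_n$, that is, its nearest point in $\hat A_n$ (one of them in case of ties). The denoised sample is $$\mathcal{Z}_m=\Big\{\pi(Y_i)+\hat R_n\frac{Y_i-\pi(Y_i)}{\|Y_i-\pi(Y_i)\|}\;:\; i\le n,\ d(Y_i,\hat A_n)>\lambda\hat R_n\Big\}.$$ Then $d_H(\mathcal{Z}_m,\mathcal{M})=O\big((\log n/n)^{1/(3d)}\big)$ almost surely; precisely, there is a constant $C$, not depending on the random outcome, such that with probability one, for all $n$ large enough, $\mathcal{Z}_m\neq\emptyset$ and $$d_H(\mathcal{Z}_m,\mathcal{M})\le C\,\Big(\frac{\log n}{n}\Big)^{1/(3d)}.$$ -/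

import Mathlib

open MeasureTheory ProbabilityTheory Filter Topology

noncomputable section

namespace Denoise

/-- The `d`-dimensional Euclidean space. -/
abbrev Space (d : ℕ) := EuclideanSpace ℝ (Fin d)

/-- `Unp(S)`: the points of the space that have a unique nearest point in `S`. -/
def unp {d : ℕ} (S : Set (Space d)) : Set (Space d) :=
  {x | ∃! p, p ∈ S ∧ dist x p = Metric.infDist x S}

/-- The local reach of `S` at `x`: the supremum (in `[0, ∞]`) of the radii `r > 0` such that the
open ball of centre `x` and radius `r` is contained in `Unp(S)`. -/
def reachAt {d : ℕ} (S : Set (Space d)) (x : Space d) : ENNReal :=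
  ⨆ (r : ℝ) (_ : 0 < r ∧ Metric.ball x r ⊆ unp S), ENNReal.ofReal r

/-- The reach of `S`, with values in `[0, ∞]` (it is infinite for closed convex sets). -/
def reach {d : ℕ} (S : Set (Space d)) : ENNReal :=
  ⨅ x ∈ S, reachAt S x

/-- The volume `ω_d` of the unit ball of the `d`-dimensional Euclidean space. -/
def unitBallVol (d : ℕ) : ℝ :=
  (volume (Metric.closedBall (0 : Space d) 1)).toReal

/-- The Devroye-Wise estimator: the union of the closed balls of radius `r` centred at the sample
points. -/
def devroyeWise {d n : ℕ} (x : Fin n → Space d) (r : ℝ) : Set (Space d) :=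
  ⋃ i, Metric.closedBall (x i) r

/-- The set `I_bb` of the indices of the boundary balls: some point of the boundary of the ball lies
on the boundary of the union of all the balls. -/
def boundaryBalls {d n : ℕ} (x : Fin n → Space d) (r : ℝ) : Set (Fin n) :=
  {j | ∃ y ∈ frontier (Metric.closedBall (x j) r), y ∈ frontier (devroyeWise x r)}

/-- The centres of the boundary balls, the estimator of the boundary of the support. -/
def boundaryCentres {d n : ℕ} (x : Fin n → Space d) (r : ℝ) : Set (Space d) :=
  x '' boundaryBalls x r

/-- The estimator `max_i min_{j ∈ I_bb} ‖x_i - x_j‖` of the noise level. -/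
def noiseLevel {d n : ℕ} (x : Fin n → Space d) (r : ℝ) : ℝ :=
  ⨆ i : Fin n, ⨅ j : boundaryBalls x r, ‖x i - x j‖

open Classical in
/-- Metric projection of `y` on `A`: a point of `A` at minimal distance from `y`. If there are
several such points one of them is chosen; if there is none (which does not happen for finite
non-empty `A`) the value is `y`. -/
def metricProj {d : ℕ} (A : Set (Space d)) (y : Space d) : Space d :=
  if h : ∃ p ∈ A, dist y p = Metric.infDist y A then h.choose else y

/-- Selection, projection and translation: the sample points at distance larger than `lam * R` from
the estimated boundary `A` are kept, and each of them is replaced by the point at distance `R` from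
its projection on `A`, in the direction from that projection to the point. -/
def denoise {d n : ℕ} (lam R : ℝ) (A : Set (Space d)) (x : Fin n → Space d) : Set (Space d) :=
  {z | ∃ i, lam * R < Metric.infDist (x i) A ∧
    z = metricProj A (x i) + (R / ‖x i - metricProj A (x i)‖) • (x i - metricProj A (x i))}

/-- The denoised sample when the boundary of the support is estimated by the centres of the boundary
balls of radius `r` and the noise level by `noiseLevel`. -/
def denoisedSample {d n : ℕ} (lam r : ℝ) (x : Fin n → Space d) : Set (Space d) :=
  denoise lam (noiseLevel x r) (boundaryCentres x r) x

/-- The radius `ε_n = c (log n / n)^(1/d)`. -/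
def radius (d : ℕ) (c : ℝ) (n : ℕ) : ℝ :=
  c * (Real.log n / n) ^ (1 / (d : ℝ))

end Denoise

end

/-! Write `s` for the distance of a sample point to `M`, and suppose the sample is an `r`-net of the
`R`-neighbourhood of `M`. Inside the reach, off `M`, the distance to `M` grows at rate arbitrarily
close to one. So the level `R + 2r` is reached from the sample point within about `R - s + 3r`, at a
point that no sample ball covers. The segment to that point crosses the frontier of the union, so a
boundary centre lies within `R - s + 4r`. Conversely, boundary centres have level at least `R - r`,
because the union covers all lower levels. Hence the distance to the estimated boundary is `R - s +
O(r)` (`infDist_boundaryCentres`) and the noise level is `R + O(r)`.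

For a selected point `y`, its nearest point `q` in `M` and its projection `a` then form an almost
degenerate triangle, and selection keeps `dist y a` away from zero. Walking the length `R + O(r)`
from `a` through `y` ends within `O(√r)` of `q` (`dist_translate_le`). This gives the exponent
`1/(2d)`, which is stronger than the stated `1/(3d)`.

The net property holds almost surely for large `n` (`ae_eventually_cover`): each small ball centred
in the support contains nearly half of its volume in the support, and a union bound over a finite
net feeds Borel–Cantelli. -/

namespace Denoise

variable {d : ℕ} {Ω : Type*} [MeasurableSpace Ω] {P : Measure Ω}

/-! ### Growth of the distance function inside the reach. -/

lemma mem_cthickening_iff_infDist_le {M : Set (Space d)} (hne : M.Nonempty) {T : ℝ} (hT : 0 ≤ T)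
    {x : Space d} : x ∈ Metric.cthickening T M ↔ Metric.infDist x M ≤ T := by
  rw [Metric.mem_cthickening_iff, Metric.infDist,
    ENNReal.le_ofReal_iff_toReal_le (Metric.infEDist_ne_top hne) hT]

/-- The reach concerns balls centred on `M`; the ball at the nearest point of `x` already contains
`x`. -/
lemma mem_unp_of_infDist_lt_reach {M : Set (Space d)} (hM : IsCompact M) (hne : M.Nonempty)
    {x : Space d} (hx : ENNReal.ofReal (Metric.infDist x M) < reach M) : x ∈ unp M := by
  obtain ⟨p, hp, hpx⟩ := hM.exists_infDist_eq_dist hne x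
  have h : ENNReal.ofReal (Metric.infDist x M) < reachAt M p :=
    lt_of_lt_of_le hx (iInf₂_le p hp)
  simp only [reachAt, lt_iSup_iff] at h
  obtain ⟨r, ⟨hr, hball⟩, hlt⟩ := h
  refine hball ?_
  rw [Metric.mem_ball, ← hpx]
  exact (ENNReal.ofReal_lt_ofReal_iff hr).1 hlt

/-- Nearest points of points close to `x` are close to the unique nearest point of `x`. -/
lemma exists_dist_nearest_lt {M : Set (Space d)} (hM : IsCompact M)
    {x p : Space d} (huniq : ∀ q ∈ M, dist x q = Metric.infDist x M → q = p)
    {η : ℝ} (hη : 0 < η) :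
    ∃ κ > 0, ∀ q ∈ M, dist x q < Metric.infDist x M + κ → dist q p < η := by
  by_cases hK : (M ∩ {q | η ≤ dist q p}).Nonempty
  · have hc : IsCompact (M ∩ {q | η ≤ dist q p}) :=
      hM.inter_right (isClosed_le continuous_const (by fun_prop))
    obtain ⟨q₀, hq₀, hmin⟩ := hc.exists_isMinOn hK
      (f := fun q => dist x q) (by fun_prop)
    have hlt : Metric.infDist x M < dist x q₀ := by
      refine lt_of_le_of_ne (Metric.infDist_le_dist_of_mem hq₀.1) fun h => ?_
      have h2 := huniq q₀ hq₀.1 h.symm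
      have h3 : η ≤ dist q₀ p := hq₀.2
      rw [h2, dist_self] at h3
      linarith
    refine ⟨dist x q₀ - Metric.infDist x M, by linarith, fun q hq hlt' => ?_⟩
    by_contra! hcon
    have : dist x q₀ ≤ dist x q := hmin ⟨hq, hcon⟩
    linarith
  · refine ⟨1, one_pos, fun q hq _ => ?_⟩
    by_contra! hcon
    exact hK ⟨q, hq, hcon⟩

/-- At a point with a unique nearest point, the distance function has upward slope one. -/
lemma exists_infDist_gt {M : Set (Space d)} (hM : IsCompact M) (hne : M.Nonempty)
    {x : Space d} (hx : x ∈ unp M) (hpos : 0 < Metric.infDist x M)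
    {δ ρ : ℝ} (hδ : 0 < δ) (hρ : 0 < ρ) :
    ∃ z, dist z x < ρ ∧ Metric.infDist x M + (1 - δ) * dist z x < Metric.infDist z M := by
  obtain ⟨p, ⟨hpM, hpx⟩, huniq⟩ := hx
  set s := Metric.infDist x M with hs
  obtain ⟨κ, hκ, hnear⟩ := exists_dist_nearest_lt hM (x := x) (p := p)
    (fun q hq h => huniq q ⟨hq, h⟩) (η := δ * s / 2) (by positivity)
  -- A nearest point `q` of `z` satisfies `dist x q ≤ s + 2h < s + κ`, hence is close to `p`.
  set h := min (ρ / 2) (κ / 4) with hh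
  have hh0 : 0 < h := by positivity
  have hnorm : ‖x - p‖ = s := by rw [← dist_eq_norm, hpx]
  set z := x + (h / s) • (x - p) with hz
  have hzx : dist z x = h := by
    rw [dist_eq_norm, hz, add_sub_cancel_left, norm_smul, hnorm, Real.norm_of_nonneg (by positivity)]
    field_simp
  obtain ⟨q, hq, hqz⟩ := hM.exists_infDist_eq_dist hne z
  have h1 : dist x q < s + κ := by
    have h2 : Metric.infDist z M ≤ s + h := by
      have := Metric.infDist_le_infDist_add_dist (s := M) (x := z) (y := x)
      rw [hzx] at this; exact this
    have h3 : dist x q ≤ h + dist z q := by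
      have := dist_triangle x z q
      rwa [dist_comm x z, hzx] at this
    have h4 : h ≤ κ / 4 := min_le_right _ _
    linarith
  have hqp := hnear q hq h1
  have hsq : s ≤ dist x q := Metric.infDist_le_dist_of_mem hq
  refine ⟨z, ?_, ?_⟩
  · rw [hzx]
    have : h ≤ ρ / 2 := min_le_left _ _
    linarith
  · rw [hzx, hqz]
    set a := dist x q with ha
    have ha' : ‖x - q‖ = a := (dist_eq_norm _ _).symm
    have ha0 : 0 < a := by linarith
    -- Cauchy–Schwarz bounds `dist z q` below by the component of `z - q` along `x - q`, a direction
    -- close to that of `x - p`.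
    have hin : a * (dist z q) ≥ inner ℝ (x - q) (z - q) := by
      rw [← ha', dist_eq_norm]
      exact real_inner_le_norm _ _
    have hzq : z - q = (x - q) + (h / s) • (x - p) := by rw [hz]; abel
    have hxp : inner ℝ (x - q) (x - p) = a ^ 2 + inner ℝ (x - q) (q - p) := by
      have : x - p = (x - q) + (q - p) := by abel
      rw [this, inner_add_right, real_inner_self_eq_norm_sq, ha']
    have hlow : -(a * (δ * s / 2)) ≤ inner ℝ (x - q) (q - p) := by
      have h5 := abs_real_inner_le_norm (x - q) (q - p)
      have h6 : ‖q - p‖ ≤ δ * s / 2 := by rw [← dist_eq_norm]; exact hqp.le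
      rw [ha'] at h5
      have h7 : a * ‖q - p‖ ≤ a * (δ * s / 2) := by gcongr
      have := neg_abs_le (inner ℝ (x - q) (q - p))
      linarith
    rw [hzq, inner_add_right, inner_smul_right, real_inner_self_eq_norm_sq, ha', hxp] at hin
    have h8 : a * (dist z q) ≥ a * (a + (h / s) * (a - δ * s / 2)) := by
      have : (h / s) * (a ^ 2 + inner ℝ (x - q) (q - p)) ≥ (h / s) * (a ^ 2 + -(a * (δ * s / 2))) := by
        gcongr
      nlinarith
    have h9 := le_of_mul_le_mul_left h8 ha0
    have h10 : (h / s) * (a - δ * s / 2) ≥ (h / s) * (s - δ * s / 2) := by gcongr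
    have h11 : (h / s) * (s - δ * s / 2) = h * (1 - δ / 2) := by field_simp
    nlinarith

/-- Away from `M` and inside the reach, the distance to `M` can be increased at rate almost one. -/
lemma exists_infDist_eq_dist_le {M : Set (Space d)} (hM : IsCompact M) (hne : M.Nonempty)
    {T : ℝ} (hT : ENNReal.ofReal T < reach M) {y : Space d} (hy0 : 0 < Metric.infDist y M)
    (hyT : Metric.infDist y M ≤ T) {δ : ℝ} (hδ : 0 < δ) (hδ1 : δ < 1) :
    ∃ z, Metric.infDist z M = T ∧ (1 - δ) * dist z y ≤ T - Metric.infDist y M := by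
  set K := {z | Metric.infDist z M ≤ T} with hK
  have hKc : IsCompact K := by
    refine Metric.isCompact_of_isClosed_isBounded
      (isClosed_le (Metric.continuous_infDist_pt M) continuous_const) ?_
    refine (hM.isBounded.cthickening (δ := T)).subset fun z hz => ?_
    exact (mem_cthickening_iff_infDist_le hne (hy0.le.trans hyT)).2 hz
  -- Ekeland-type argument: a maximiser of the penalised distance below level `T` could be improved
  -- by a short move of slope above `1 - δ`.
  obtain ⟨z, hz, hmax⟩ := hKc.exists_isMaxOn (f := fun z => Metric.infDist z M - (1 - δ) * dist z y)
    ⟨y, hyT⟩ (((Metric.continuous_infDist_pt M).sub (by fun_prop)).continuousOn)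
  have hzy : Metric.infDist y M - (1 - δ) * dist y y ≤ Metric.infDist z M - (1 - δ) * dist z y :=
    hmax (show y ∈ K from hyT)
  rw [dist_self, mul_zero, sub_zero] at hzy
  have hnn : 0 ≤ (1 - δ) * dist z y := mul_nonneg (by linarith) dist_nonneg
  have hzT : Metric.infDist z M ≤ T := hz
  have heq : Metric.infDist z M = T := by
    by_contra hcon
    have hlt := lt_of_le_of_ne hzT hcon
    obtain ⟨w, hw1, hw2⟩ := exists_infDist_gt hM hne
      (mem_unp_of_infDist_lt_reach hM hne
        (lt_of_le_of_lt (ENNReal.ofReal_le_ofReal hzT) hT)) (by linarith) hδ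
        (ρ := T - Metric.infDist z M) (by linarith)
    have hwK : w ∈ K := by
      have := Metric.infDist_le_infDist_add_dist (s := M) (x := w) (y := z)
      show Metric.infDist w M ≤ T
      linarith
    have h3 : Metric.infDist w M - (1 - δ) * dist w y ≤ Metric.infDist z M - (1 - δ) * dist z y :=
      hmax hwK
    have h4 := dist_triangle w z y
    have h5 : (1 - δ) * dist w y ≤ (1 - δ) * (dist w z + dist z y) :=
      mul_le_mul_of_nonneg_left h4 (by linarith)
    linarith
  exact ⟨z, heq, by rw [← heq]; linarith⟩

/-- From every point of the `T`-neighbourhood of `M`, the level `T` of the distance function is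
reached within the distance given by the difference of the levels, up to an arbitrary error. -/
lemma exists_infDist_eq_dist_lt {M : Set (Space d)} (hM : IsCompact M) (hne : M.Nonempty)
    (hMint : interior M = ∅) {T : ℝ} (hT : ENNReal.ofReal T < reach M) {y : Space d}
    (hyT : Metric.infDist y M < T) {η : ℝ} (hη : 0 < η) :
    ∃ z, Metric.infDist z M = T ∧ dist z y < T - Metric.infDist y M + η := by
  have hpos : ∀ y : Space d, 0 < Metric.infDist y M → Metric.infDist y M < T → ∀ η > 0,
      ∃ z, Metric.infDist z M = T ∧ dist z y < T - Metric.infDist y M + η := by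
    intro y hy0 hyT η hη
    set a := T - Metric.infDist y M with ha
    have ha0 : 0 < a := by linarith
    -- Chosen so that `(1 - δ)(a + η) = a + η/2` exceeds `a`.
    set δ := η / (2 * (a + η)) with hδ
    have hδ0 : 0 < δ := by positivity
    have hδ1 : δ < 1 := by rw [hδ, div_lt_one (by positivity)]; linarith
    obtain ⟨z, hz, hzy⟩ := exists_infDist_eq_dist_le hM hne hT hy0 hyT.le hδ0 hδ1
    refine ⟨z, hz, ?_⟩
    by_contra! hcon
    have h1 : (1 - δ) * (a + η) ≤ (1 - δ) * dist z y :=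
      mul_le_mul_of_nonneg_left hcon (by linarith)
    have h2 : δ * (a + η) = η / 2 := by rw [hδ]; field_simp
    nlinarith
  -- Points of `M` have no ascent direction at hand; empty interior allows a perturbation off `M`,
  -- costing `η/3` in level and `η/3` in distance.
  have hdense : Dense Mᶜ := interior_eq_empty_iff_dense_compl.1 hMint
  obtain ⟨y', hy'M, hy'⟩ := hdense.exists_dist_lt y
    (ε := min (η / 3) (T - Metric.infDist y M)) (lt_min (by positivity) (by linarith))
  have h1 : dist y y' < η / 3 := lt_of_lt_of_le hy' (min_le_left _ _)
  have h2 : dist y y' < T - Metric.infDist y M := lt_of_lt_of_le hy' (min_le_right _ _)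
  have h3 := Metric.infDist_le_infDist_add_dist (s := M) (x := y') (y := y)
  have h4 := Metric.infDist_le_infDist_add_dist (s := M) (x := y) (y := y')
  rw [dist_comm y' y] at h3
  obtain ⟨z, hz, hzy⟩ := hpos y' ((hM.isClosed.notMem_iff_infDist_pos hne).1 hy'M)
    (by linarith) (η / 3) (by positivity)
  refine ⟨z, hz, ?_⟩
  have := dist_triangle z y' y
  rw [dist_comm y' y] at this
  linarith

/-! ### Boundary balls of the Devroye-Wise estimator. -/

lemma _root_.IsPreconnected.exists_mem_frontier {X : Type*} [TopologicalSpace X] {s t : Set X}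
    (hs : IsPreconnected s) (h1 : (s ∩ t).Nonempty) (h2 : (s ∩ tᶜ).Nonempty) :
    ∃ y ∈ s, y ∈ frontier t := by
  by_contra! hcon
  obtain ⟨a, has, hat⟩ := h1
  obtain ⟨b, hbs, hbt⟩ := h2
  have hsub : s ⊆ interior t ∪ (closure t)ᶜ := by
    intro y hy
    by_cases hyt : y ∈ closure t
    · left
      by_contra hyi
      exact hcon y hy ⟨hyt, hyi⟩
    · exact Or.inr hyt
  obtain ⟨y, -, hy1, hy2⟩ := hs _ _ isOpen_interior isClosed_closure.isOpen_compl hsub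
    ⟨a, has, (hsub has).resolve_right fun h => h (subset_closure hat)⟩
    ⟨b, hbs, (hsub hbs).resolve_left fun h => hbt (interior_subset h)⟩
  exact hy2 (subset_closure (interior_subset hy1))

lemma isClosed_devroyeWise {n : ℕ} (x : Fin n → Space d) (r : ℝ) :
    IsClosed (devroyeWise x r) :=
  isClosed_iUnion_of_finite fun _ => Metric.isClosed_closedBall

/-- The segment from a sample point to a point outside the Devroye-Wise estimator meets a
boundary ball. -/
lemma exists_mem_boundaryBalls {n : ℕ} (x : Fin n → Space d) {r : ℝ} (hr : 0 < r) (i : Fin n)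
    {z : Space d} (hz : z ∉ devroyeWise x r) :
    ∃ j ∈ boundaryBalls x r, dist (x i) (x j) ≤ dist (x i) z + r := by
  obtain ⟨y, hys, hyf⟩ := (convex_segment (𝕜 := ℝ) (x i) z).isPreconnected.exists_mem_frontier
    (t := devroyeWise x r)
    ⟨x i, left_mem_segment ℝ _ _, Set.mem_iUnion.2 ⟨i, Metric.mem_closedBall_self hr.le⟩⟩
    ⟨z, right_mem_segment ℝ _ _, hz⟩
  obtain ⟨j, hj⟩ := Set.mem_iUnion.1 ((isClosed_devroyeWise x r).frontier_subset hyf)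
  -- A point interior to one ball is interior to the union, so `y` lies on the sphere.
  refine ⟨j, ⟨y, ⟨subset_closure hj, fun hint => hyf.2 ?_⟩, hyf⟩, ?_⟩
  · exact interior_mono (Set.subset_iUnion _ j) hint
  · have h1 : dist (x i) y ≤ dist (x i) z := by
      have := dist_add_dist_of_mem_segment hys
      have := dist_nonneg (x := y) (y := z)
      linarith
    have h2 := dist_triangle (x i) y (x j)
    have h3 : dist y (x j) ≤ r := hj
    linarith

lemma infDist_le_add_of_devroyeWise {n : ℕ} {M : Set (Space d)} {R r : ℝ} {x : Fin n → Space d}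
    (hx : ∀ i, Metric.infDist (x i) M ≤ R) {z : Space d} (hz : z ∈ devroyeWise x r) :
    Metric.infDist z M ≤ R + r := by
  obtain ⟨i, hi⟩ := Set.mem_iUnion.1 hz
  have h1 : dist z (x i) ≤ r := hi
  have := Metric.infDist_le_infDist_add_dist (s := M) (x := z) (y := x i)
  linarith [hx i]

/-- The centres of the boundary balls are close to the boundary of the support. -/
lemma sub_le_infDist_of_mem_boundaryBalls {n : ℕ} {M : Set (Space d)} {R r : ℝ}
    {x : Fin n → Space d} (hcov : ∀ y, Metric.infDist y M ≤ R → ∃ i, dist y (x i) ≤ r)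
    {j : Fin n} (hj : j ∈ boundaryBalls x r) : R - r ≤ Metric.infDist (x j) M := by
  obtain ⟨y, hyj, hyf⟩ := hj
  have h1 : dist y (x j) ≤ r := Metric.isClosed_closedBall.frontier_subset hyj
  have h2 : R ≤ Metric.infDist y M := by
    by_contra! hlt
    suffices hsub : {y | Metric.infDist y M < R} ⊆ devroyeWise x r from
      hyf.2 (interior_maximal hsub
        (isOpen_lt (Metric.continuous_infDist_pt M) continuous_const) hlt)
    intro w hw
    obtain ⟨i, hi⟩ := hcov w (le_of_lt hw)
    exact Set.mem_iUnion.2 ⟨i, hi⟩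
  have := Metric.infDist_le_infDist_add_dist (s := M) (x := y) (y := x j)
  linarith

lemma isCompact_boundaryCentres {n : ℕ} (x : Fin n → Space d) (r : ℝ) :
    IsCompact (boundaryCentres x r) :=
  ((Set.toFinite (boundaryBalls x r)).image x).isCompact

lemma iInf_norm_eq_infDist {n : ℕ} {x : Fin n → Space d} {r : ℝ}
    (hne : (boundaryCentres x r).Nonempty) (y : Space d) :
    ⨅ j : boundaryBalls x r, ‖y - x j‖ = Metric.infDist y (boundaryCentres x r) := by
  obtain ⟨p, ⟨j, hj, rfl⟩, hp⟩ := (isCompact_boundaryCentres x r).exists_infDist_eq_dist hne y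
  have : Nonempty (boundaryBalls x r) := ⟨⟨j, hj⟩⟩
  apply le_antisymm
  · rw [hp, dist_eq_norm]
    exact ciInf_le (Set.finite_range _).bddBelow (⟨j, hj⟩ : boundaryBalls x r)
  · refine le_ciInf fun k => ?_
    rw [← dist_eq_norm]
    exact Metric.infDist_le_dist_of_mem ⟨k, k.2, rfl⟩

/-! ### Projection, translation and the deterministic bounds. -/

lemma metricProj_spec {A : Set (Space d)} (hA : IsCompact A) (hne : A.Nonempty) (y : Space d) :
    metricProj A y ∈ A ∧ dist y (metricProj A y) = Metric.infDist y A := by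
  have h : ∃ p ∈ A, dist y p = Metric.infDist y A := by
    obtain ⟨p, hp, hpy⟩ := hA.exists_infDist_eq_dist hne y
    exact ⟨p, hp, hpy.symm⟩
  rw [metricProj, dif_pos h]
  exact h.choose_spec

/-- If `y` almost realises equality in the triangle inequality for `q`, `y`, `a`, then walking from
`a` towards `y` for a length close to `dist q a` leads close to `q`. -/
lemma dist_translate_le {E : Type*} [NormedAddCommGroup E] [InnerProductSpace ℝ E] {q y a : E}
    {s b L R κ τ : ℝ} (hs : dist y q = s) (hb : dist y a = b) (hb0 : 0 < b)
    (hL0 : 0 ≤ L) (hL : L ≤ dist a q) (hκ : s / b * ((s + b) ^ 2 - L ^ 2) ≤ κ ^ 2) (hκ0 : 0 ≤ κ)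
    (hR : |R - b - s| ≤ τ) :
    dist (a + (R / ‖y - a‖) • (y - a)) q ≤ κ + τ := by
  rw [dist_eq_norm] at hs hb hL
  set w := y - q with hw
  set v := y - a with hv
  -- The first term vanishes for a degenerate triangle, where `w` and `v` are opposite; the second
  -- is the error in the walking length.
  have hsplit : a + (R / ‖v‖) • v - q = (w + (s / b) • v) + ((R - b - s) / b) • v := by
    have : (R - b - s) / b = R / b - 1 - s / b := by field_simp
    rw [hb, this, hw, hv]; module
  have haq : a - q = w - v := by rw [hw, hv]; abel
  have hs0 : 0 ≤ s := hs ▸ norm_nonneg _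
  have h1 : L ^ 2 ≤ s ^ 2 - 2 * inner ℝ w v + b ^ 2 := by
    rw [← hs, ← hb, ← norm_sub_sq_real, ← haq]
    gcongr
  have h2 : ‖w + (s / b) • v‖ ^ 2 ≤ κ ^ 2 := by
    have h3 : ‖(s / b) • v‖ = s := by
      rw [norm_smul, hb, Real.norm_of_nonneg (by positivity)]; field_simp
    rw [norm_add_sq_real, h3, hs, inner_smul_right]
    refine le_trans ?_ hκ
    have h4 : s / b * (2 * inner ℝ w v) ≤ s / b * (s ^ 2 + b ^ 2 - L ^ 2) := by
      gcongr; linarith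
    have h5 : s / b * ((s + b) ^ 2 - L ^ 2) = 2 * s ^ 2 + s / b * (s ^ 2 + b ^ 2 - L ^ 2) := by
      field_simp; ring
    linarith
  have h6 : ‖((R - b - s) / b) • v‖ ≤ τ := by
    rw [norm_smul, hb, Real.norm_eq_abs, abs_div, abs_of_pos hb0, div_mul_cancel₀ _ hb0.ne']
    exact hR
  rw [dist_eq_norm, hsplit]
  exact (norm_add_le _ _).trans (add_le_add ((sq_le_sq₀ (norm_nonneg _) hκ0).1 h2) h6)

/-- The sample points are at the expected distance from the estimated boundary. -/
lemma infDist_boundaryCentres {n : ℕ} {M : Set (Space d)} (hM : IsCompact M) (hne : M.Nonempty)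
    (hMint : interior M = ∅) {R r : ℝ} (hr : 0 < r)
    (hreach : ENNReal.ofReal (R + 2 * r) < reach M)
    {x : Fin n → Space d} (hx : ∀ i, Metric.infDist (x i) M ≤ R)
    (hcov : ∀ y, Metric.infDist y M ≤ R → ∃ i, dist y (x i) ≤ r) (i : Fin n) :
    (boundaryCentres x r).Nonempty ∧
      R - r - Metric.infDist (x i) M ≤ Metric.infDist (x i) (boundaryCentres x r) ∧
      Metric.infDist (x i) (boundaryCentres x r) ≤ R - Metric.infDist (x i) M + 4 * r := by
  obtain ⟨z, hzT, hz⟩ := exists_infDist_eq_dist_lt hM hne hMint hreach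
    (y := x i) (by linarith [hx i]) hr
  have hzS : z ∉ devroyeWise x r := fun h => by
    have := infDist_le_add_of_devroyeWise hx h
    linarith
  obtain ⟨j, hj, hij⟩ := exists_mem_boundaryBalls x hr i hzS
  have hjA : x j ∈ boundaryCentres x r := ⟨j, hj, rfl⟩
  refine ⟨⟨_, hjA⟩, ?_, ?_⟩
  · obtain ⟨p, ⟨k, hk, rfl⟩, hp⟩ :=
      (isCompact_boundaryCentres x r).exists_infDist_eq_dist ⟨_, hjA⟩ (x i)
    have h1 := sub_le_infDist_of_mem_boundaryBalls hcov hk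
    have h2 := Metric.infDist_le_infDist_add_dist (s := M) (x := x k) (y := x i)
    rw [hp, dist_comm (x i)]
    linarith
  · have := Metric.infDist_le_dist_of_mem hjA (x := x i)
    rw [dist_comm (x i) z] at hij
    linarith

/-- The lower bound comes from a sample point within `r` of `M`, the upper one from `s ≥ 0`. -/
lemma noiseLevel_bounds {n : ℕ} {M : Set (Space d)} (hM : IsCompact M) (hne : M.Nonempty)
    (hMint : interior M = ∅) {R r : ℝ} (hR : 0 ≤ R) (hr : 0 < r)
    (hreach : ENNReal.ofReal (R + 2 * r) < reach M)
    {x : Fin n → Space d} (hx : ∀ i, Metric.infDist (x i) M ≤ R)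
    (hcov : ∀ y, Metric.infDist y M ≤ R → ∃ i, dist y (x i) ≤ r) :
    R - 2 * r ≤ noiseLevel x r ∧ noiseLevel x r ≤ R + 4 * r := by
  obtain ⟨p, hp⟩ := hne
  obtain ⟨i, hi⟩ := hcov p (by rw [Metric.infDist_zero_of_mem hp]; exact hR)
  have key := infDist_boundaryCentres hM ⟨p, hp⟩ hMint hr hreach hx hcov
  have hA := (key i).1
  have hxi : Metric.infDist (x i) M ≤ r := by
    have := Metric.infDist_le_dist_of_mem hp (x := x i)
    rw [dist_comm] at this
    linarith
  have hNe : Nonempty (Fin n) := ⟨i⟩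
  simp only [noiseLevel, iInf_norm_eq_infDist hA]
  constructor
  · refine le_trans ?_ (le_ciSup (Set.finite_range _).bddAbove i)
    linarith [(key i).2.1]
  · refine ciSup_le fun k => ?_
    have := (key k).2.2
    have := Metric.infDist_nonneg (x := x k) (s := M)
    linarith

/-- Deterministic error bound for the denoised sample, when the sample is an `r`-net of the
support. -/
lemma hausdorffDist_denoisedSample_le {n : ℕ} {M : Set (Space d)} (hM : IsCompact M)
    (hne : M.Nonempty) (hMint : interior M = ∅) {R r lam : ℝ} (hr : 0 < r) (hrR : 4 * r ≤ R)
    (hlam : 0 < lam) (hlamr : lam * (R + 4 * r) < R - 2 * r)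
    (hreach : ENNReal.ofReal (R + 2 * r) < reach M)
    {x : Fin n → Space d} (hx : ∀ i, Metric.infDist (x i) M ≤ R)
    (hcov : ∀ y, Metric.infDist y M ≤ R → ∃ i, dist y (x i) ≤ r) :
    (denoisedSample lam r x).Nonempty ∧
      Metric.hausdorffDist (denoisedSample lam r x) M ≤ √(30 * R / lam * r) + 8 * r := by
  have hR : 0 < R := by linarith
  obtain ⟨hN1, hN2⟩ := noiseLevel_bounds hM hne hMint hR.le hr hreach hx hcov
  set N := noiseLevel x r with hN
  set A := boundaryCentres x r with hA
  set κ := √(30 * R / lam * r) with hκ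
  have key := infDist_boundaryCentres hM hne hMint hr hreach hx hcov
  have hpt : ∀ i, lam * N < Metric.infDist (x i) A → ∀ q ∈ M,
      Metric.infDist (x i) M = dist (x i) q →
      dist (metricProj A (x i) + (N / ‖x i - metricProj A (x i)‖) • (x i - metricProj A (x i))) q
        ≤ κ + 6 * r := by
    intro i hi q hq hiq
    obtain ⟨hAne, hlow, hup⟩ := key i
    obtain ⟨hpA, hpd⟩ := metricProj_spec (isCompact_boundaryCentres x r) hAne (x i)
    obtain ⟨j, hj, hpj⟩ := hpA
    have hL : R - r ≤ dist (metricProj A (x i)) q := by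
      rw [← hpj]
      exact (sub_le_infDist_of_mem_boundaryBalls hcov hj).trans (Metric.infDist_le_dist_of_mem hq)
    have hs0 := Metric.infDist_nonneg (x := x i) (s := M)
    have hsR := hx i
    have hb : lam * (R / 2) ≤ Metric.infDist (x i) A := by
      refine le_trans ?_ hi.le
      gcongr
      linarith
    have hb0 : 0 < Metric.infDist (x i) A := lt_of_lt_of_le (by positivity) hb
    refine dist_translate_le hiq.symm hpd hb0 (by linarith) hL ?_ (Real.sqrt_nonneg _) ?_
    · rw [Real.sq_sqrt (by positivity)]
      set s := Metric.infDist (x i) M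
      set b := Metric.infDist (x i) A
      -- From `s + b ≤ R + 4r`, the difference is at most `10Rr + 15r²`, and `4r ≤ R`.
      have h1 : (s + b) ^ 2 - (R - r) ^ 2 ≤ 15 * R * r := by nlinarith
      have h2 : s / b ≤ 2 / lam := by
        rw [div_le_div_iff₀ hb0 hlam]
        nlinarith
      calc s / b * ((s + b) ^ 2 - (R - r) ^ 2) ≤ s / b * (15 * R * r) := by gcongr
        _ ≤ 2 / lam * (15 * R * r) := by gcongr
        _ = 30 * R / lam * r := by ring
    · rw [abs_le]
      constructor <;> linarith
  have hsel : ∀ p ∈ M, ∃ z ∈ denoisedSample lam r x, dist p z ≤ κ + 8 * r := by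
    intro p hp
    obtain ⟨i, hi⟩ := hcov p (by rw [Metric.infDist_zero_of_mem hp]; exact hR.le)
    have hxi : Metric.infDist (x i) M ≤ r := by
      have := Metric.infDist_le_dist_of_mem hp (x := x i)
      rw [dist_comm] at this
      linarith
    have hlow := (key i).2.1
    have hiA : lam * N < Metric.infDist (x i) A := by
      -- Sample points within `r` of `M` pass the selection: this is the role of `hlamr`.
      have : lam * N ≤ lam * (R + 4 * r) := by gcongr
      linarith
    obtain ⟨q, hq, hiq⟩ := hM.exists_infDist_eq_dist hne (x i)
    refine ⟨_, ⟨i, hiA, rfl⟩, ?_⟩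
    have h1 := hpt i hiA q hq hiq
    have h2 := dist_triangle p (x i) q
    rw [dist_comm] at h1
    exact (dist_triangle p q _).trans (by linarith)
  constructor
  · obtain ⟨p, hp⟩ := hne
    obtain ⟨z, hz, -⟩ := hsel p hp
    exact ⟨z, hz⟩
  · refine Metric.hausdorffDist_le_of_mem_dist (by positivity) ?_ hsel
    rintro _ ⟨i, hi, rfl⟩
    obtain ⟨q, hq, hiq⟩ := hM.exists_infDist_eq_dist hne (x i)
    exact ⟨q, hq, (hpt i hi q hq hiq).trans (by linarith)⟩

/-! ### Mass of small balls centred in the support. -/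

open scoped Pointwise in
/-- A half ball has at least half of the volume of the ball. -/
lemma unitBallVol_le_two_mul_halfBall (e : Space d) :
    unitBallVol d ≤ 2 * volume.real (Metric.closedBall (0 : Space d) 1 ∩ {u | 0 ≤ inner ℝ u e}) := by
  set H := Metric.closedBall (0 : Space d) 1 ∩ {u | 0 ≤ inner ℝ u e} with hH
  have hfin : volume H ≠ ⊤ :=
    measure_ne_top_of_subset Set.inter_subset_left measure_closedBall_lt_top.ne
  have hneg : volume.real (-H) = volume.real H := by
    simp [measureReal_def, Measure.measure_neg]
  have hsub : Metric.closedBall (0 : Space d) 1 ⊆ H ∪ -H := by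
    intro u hu
    rcases le_total 0 (inner ℝ u e) with h | h
    · exact Or.inl ⟨hu, h⟩
    · refine Or.inr ⟨by simpa using hu, ?_⟩
      simp only [Set.mem_ofPred_eq, inner_neg_left]
      linarith
  calc unitBallVol d = volume.real (Metric.closedBall (0 : Space d) 1) := rfl
    _ ≤ volume.real (H ∪ -H) := measureReal_mono hsub
        (measure_union_ne_top hfin (by rwa [Measure.measure_neg]))
    _ ≤ volume.real H + volume.real (-H) := measureReal_union_le _ _
    _ = 2 * volume.real H := by rw [hneg]; ring

open scoped Pointwise in
/-- A ball centred in a larger ball meets it in almost half of its volume. -/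
lemma volume_closedBall_inter_closedBall_ge (hd : d ≠ 0) {x p : Space d} {r R : ℝ} (hr : 0 < r)
    (hrR : r ≤ R) (hxp : dist x p ≤ R) :
    unitBallVol d * (r * (1 - r / (2 * R))) ^ d / 2 ≤
      volume.real (Metric.closedBall x r ∩ Metric.closedBall p R) := by
  have hR : 0 < R := by linarith
  obtain ⟨e, he, hpe⟩ : ∃ e : Space d, ‖e‖ = 1 ∧ p - x = dist x p • e := by
    rcases eq_or_ne x p with rfl | hne
    · have : NeZero d := ⟨hd⟩
      exact ⟨EuclideanSpace.single 0 1, by simp, by simp⟩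
    · have h0 : ‖p - x‖ ≠ 0 := norm_ne_zero_iff.2 (sub_ne_zero.2 hne.symm)
      refine ⟨‖p - x‖⁻¹ • (p - x), by rw [norm_smul, norm_inv, norm_norm, inv_mul_cancel₀ h0], ?_⟩
      rw [dist_comm, dist_eq_norm, smul_smul, mul_inv_cancel₀ h0, one_smul]
  set s := dist x p with hs
  have hs0 : 0 ≤ s := dist_nonneg
  set t := r / (2 * R) with ht
  have ht0 : 0 < t := by positivity
  have ht1 : t ≤ 1 / 2 := by rw [ht, div_le_div_iff₀ (by positivity) (by norm_num)]; linarith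
  set H := Metric.closedBall (0 : Space d) 1 ∩ {u | 0 ≤ inner ℝ u e} with hH
  -- The half ball facing `p` is shrunk by `1 - t` and pushed by `rt` towards `p`. With `2Rt = r`,
  -- membership in the large ball reduces to `(R - s)(R + s - 2rt) ≥ 0`.
  have hsub : (fun u => (x + (r * t) • e) + u) '' ((r * (1 - t)) • H) ⊆
      Metric.closedBall x r ∩ Metric.closedBall p R := by
    rintro _ ⟨_, ⟨u, ⟨hu1, hu2⟩, rfl⟩, rfl⟩
    have hu1 : ‖u‖ ≤ 1 := by simpa using hu1
    have hu2 : 0 ≤ inner ℝ u e := hu2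
    set v := (1 - t) • u + t • e with hv
    have hvn : ‖v‖ ≤ 1 := by
      refine (norm_add_le _ _).trans ?_
      rw [norm_smul, norm_smul, he, Real.norm_of_nonneg (by linarith), Real.norm_of_nonneg ht0.le]
      nlinarith
    have hve : t ≤ inner ℝ v e := by
      rw [hv, inner_add_left, inner_smul_left, inner_smul_left, real_inner_self_eq_norm_sq, he]
      have : 0 ≤ (1 - t) * inner ℝ u e := mul_nonneg (by linarith) hu2
      simpa using this
    have hz : x + (r * t) • e + (r * (1 - t)) • u = x + r • v := by
      rw [hv]; module
    simp only
    rw [hz]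
    constructor
    · rw [Metric.mem_closedBall, dist_eq_norm, add_sub_cancel_left, norm_smul,
        Real.norm_of_nonneg hr.le]
      nlinarith
    · rw [Metric.mem_closedBall, dist_eq_norm]
      have h1 : x + r • v - p = r • v - s • e := by rw [← hpe]; abel
      refine (sq_le_sq₀ (norm_nonneg _) hR.le).1 ?_
      rw [h1, norm_sub_sq_real, norm_smul, norm_smul, he, inner_smul_left, inner_smul_right,
        Real.norm_of_nonneg hr.le, Real.norm_of_nonneg hs0]
      simp only [conj_trivial]
      have h2 : (r * ‖v‖) ^ 2 ≤ r ^ 2 := by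
        have : r * ‖v‖ ≤ r := by nlinarith
        gcongr
      have h3 : r * (s * t) ≤ r * (s * inner ℝ v e) := by gcongr
      have h4 : 2 * R * t = r := by rw [ht]; field_simp
      have h5 : 0 ≤ (R - s) * (R + s - r * t * 2) := by
        apply mul_nonneg (by linarith)
        nlinarith
      nlinarith
  have hvol : volume.real ((fun u => (x + (r * t) • e) + u) '' ((r * (1 - t)) • H)) =
      (r * (1 - t)) ^ d * volume.real H := by
    have h0 : 0 ≤ (r * (1 - t)) ^ d := pow_nonneg (mul_nonneg hr.le (by linarith)) d
    rw [Set.image_add_left, measureReal_def, measure_preimage_add, Measure.addHaar_smul,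
      finrank_euclideanSpace_fin, ENNReal.toReal_mul, abs_of_nonneg h0, ENNReal.toReal_ofReal h0]
    rfl
  refine le_trans ?_ (measureReal_mono hsub
    (measure_ne_top_of_subset Set.inter_subset_left measure_closedBall_lt_top.ne))
  rw [hvol]
  have := unitBallVol_le_two_mul_halfBall e
  have h0 : 0 ≤ (r * (1 - t)) ^ d := pow_nonneg (mul_nonneg hr.le (by linarith)) d
  nlinarith [mul_le_mul_of_nonneg_left this h0]

lemma measureReal_ge_of_density_ge {α : Type*} [MeasurableSpace α] {μ ν : Measure α}
    [IsFiniteMeasure μ] {S B : Set α} {f₀ : ℝ} (hf₀ : 0 ≤ f₀)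
    (hdens : ∀ᵐ y ∂(ν.restrict S), ENNReal.ofReal f₀ ≤ μ.rnDeriv ν y) :
    f₀ * ν.real (B ∩ S) ≤ μ.real B := by
  have h : ENNReal.ofReal f₀ * ν (B ∩ S) ≤ μ B := by
    calc ENNReal.ofReal f₀ * ν (B ∩ S) = ∫⁻ _ in B ∩ S, ENNReal.ofReal f₀ ∂ν := by
          rw [setLIntegral_const]
      _ ≤ ∫⁻ y in B ∩ S, μ.rnDeriv ν y ∂ν :=
          lintegral_mono_ae (ae_restrict_of_ae_restrict_of_subset Set.inter_subset_right hdens)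
      _ ≤ μ (B ∩ S) := Measure.setLIntegral_rnDeriv_le _
      _ ≤ μ B := measure_mono Set.inter_subset_left
  have h2 := ENNReal.toReal_mono (measure_ne_top μ B) h
  rwa [ENNReal.toReal_mul, ENNReal.toReal_ofReal hf₀] at h2

/-- The support contains the ball of radius `R` about the nearest point of `x` in `M`, so the
two-ball estimate applies. -/
lemma measureReal_closedBall_ge (hd : d ≠ 0) {M : Set (Space d)} (hM : IsCompact M)
    (hne : M.Nonempty) {R : ℝ} {μ : Measure (Space d)} [IsFiniteMeasure μ]
    {f₀ : ℝ} (hf₀ : 0 ≤ f₀)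
    (hdens : ∀ᵐ y ∂(volume.restrict (Metric.cthickening R M)),
      ENNReal.ofReal f₀ ≤ μ.rnDeriv volume y)
    {x : Space d} (hx : Metric.infDist x M ≤ R) {r : ℝ} (hr : 0 < r) (hrR : r ≤ R) :
    f₀ * (unitBallVol d * (r * (1 - r / (2 * R))) ^ d / 2) ≤ μ.real (Metric.closedBall x r) := by
  refine le_trans ?_ (measureReal_ge_of_density_ge hf₀ hdens)
  obtain ⟨p, hp, hpx⟩ := hM.exists_infDist_eq_dist hne x
  refine mul_le_mul_of_nonneg_left ((volume_closedBall_inter_closedBall_ge hd hr hrR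
    (hpx ▸ hx)).trans ?_) hf₀
  refine measureReal_mono ?_
    (measure_ne_top_of_subset Set.inter_subset_left measure_closedBall_lt_top.ne)
  exact Set.inter_subset_inter_right _ (Metric.closedBall_subset_cthickening hp R)

/-! ### Finite nets by volume packing. -/

lemma unitBallVol_pos : 0 < unitBallVol d :=
  ENNReal.toReal_pos (Metric.measure_closedBall_pos _ _ one_pos).ne' measure_closedBall_lt_top.ne

/-- Volume bound for the cardinality of a separated set. -/
lemma card_mul_pow_le_of_separated {D δ : ℝ} (hD : 0 ≤ D) (hδ : 0 < δ) {N : Finset (Space d)}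
    (hN : ∀ x ∈ N, ‖x‖ ≤ D) (hsep : (N : Set (Space d)).Pairwise fun x y => δ < dist x y) :
    (N.card : ℝ) * (δ / 2) ^ d ≤ (D + δ / 2) ^ d := by
  have hdisj : (N : Set (Space d)).PairwiseDisjoint fun x => Metric.ball x (δ / 2) := by
    intro x hx y hy hxy
    exact Metric.ball_disjoint_ball (by linarith [hsep hx hy hxy])
  have h1 : volume.real (⋃ x ∈ N, Metric.ball x (δ / 2)) = N.card * ((δ / 2) ^ d * unitBallVol d) := by
    rw [measureReal_biUnion_finset hdisj fun _ _ => measurableSet_ball]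
    have : ∀ x ∈ N, volume.real (Metric.ball x (δ / 2)) = (δ / 2) ^ d * unitBallVol d := by
      intro x _
      rw [measureReal_def, Measure.addHaar_ball_of_pos _ _ (by positivity), finrank_euclideanSpace_fin,
        ENNReal.toReal_mul, ENNReal.toReal_ofReal (by positivity), unitBallVol,
        Measure.addHaar_unitClosedBall_eq_addHaar_unitBall]
    rw [Finset.sum_congr rfl this, Finset.sum_const, nsmul_eq_mul]
  have h2 : volume.real (Metric.closedBall (0 : Space d) (D + δ / 2)) =
      (D + δ / 2) ^ d * unitBallVol d := by
    rw [Measure.addHaar_real_closedBall' _ _ (by positivity), finrank_euclideanSpace_fin]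
    rfl
  have h3 : volume.real (⋃ x ∈ N, Metric.ball x (δ / 2)) ≤
      volume.real (Metric.closedBall (0 : Space d) (D + δ / 2)) := by
    refine measureReal_mono ?_ measure_closedBall_lt_top.ne
    refine Set.iUnion₂_subset fun x hx y hy => ?_
    rw [mem_closedBall_zero_iff]
    have h4 : ‖y - x‖ < δ / 2 := by rw [← dist_eq_norm]; exact hy
    have := norm_le_norm_add_norm_sub' y x
    linarith [hN x hx]
  rw [h1, h2, ← mul_assoc] at h3
  exact le_of_mul_le_mul_right h3 unitBallVol_pos

/-- Bounded sets have nets of controlled cardinality. -/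
lemma exists_finset_net {S : Set (Space d)} {D δ : ℝ} (hD : 0 ≤ D) (hδ : 0 < δ)
    (hS : ∀ x ∈ S, ‖x‖ ≤ D) :
    ∃ N : Finset (Space d), (N : Set (Space d)) ⊆ S ∧ (∀ x ∈ S, ∃ y ∈ N, dist x y ≤ δ) ∧
      (N.card : ℝ) * (δ / 2) ^ d ≤ (D + δ / 2) ^ d := by
  classical
  by_contra! hcon
  -- Greedy choice: a separated set satisfies the cardinality bound, so it is not a net and can be
  -- enlarged, without end.
  have hk : ∀ k : ℕ, ∃ N : Finset (Space d), (N : Set (Space d)) ⊆ S ∧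
      (N : Set (Space d)).Pairwise (fun x y => δ < dist x y) ∧ N.card = k := by
    intro k
    induction k with
    | zero => exact ⟨∅, by simp, by simp, rfl⟩
    | succ k ih =>
      obtain ⟨N, hNS, hsep, hcard⟩ := ih
      have hbound := card_mul_pow_le_of_separated hD hδ (fun x hx => hS x (hNS hx)) hsep
      have : ∃ x ∈ S, ∀ y ∈ N, δ < dist x y := by
        by_contra! hcov
        exact absurd hbound (not_le.2 (hcon N hNS hcov))
      obtain ⟨x, hx, hxN⟩ := this
      have hxmem : x ∉ N := fun h => by
        have := hxN x h
        rw [dist_self] at this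
        linarith
      refine ⟨insert x N, ?_, ?_, by rw [Finset.card_insert_of_notMem hxmem, hcard]⟩
      · rw [Finset.coe_insert]
        exact Set.insert_subset hx hNS
      · rw [Finset.coe_insert]
        refine hsep.insert fun y hy _ => ⟨hxN y hy, ?_⟩
        rw [dist_comm]
        exact hxN y hy
  obtain ⟨k, hk'⟩ := exists_nat_gt ((D + δ / 2) ^ d / (δ / 2) ^ d)
  obtain ⟨N, hNS, hsep, rfl⟩ := hk k
  have hbound := card_mul_pow_le_of_separated hD hδ (fun x hx => hS x (hNS hx)) hsep
  rw [div_lt_iff₀ (by positivity)] at hk'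
  linarith

/-! ### Almost sure covering by the sample. -/

/-- The probability that a set is not hit by the first `n` points of the sample. -/
lemma measureReal_forall_notMem_le {α : Type*} [MeasurableSpace α] {μ : Measure α}
    [IsProbabilityMeasure μ] {Y : ℕ → Ω → α} (hlaw : ∀ i, HasLaw (Y i) μ P)
    (hindep : iIndepFun Y P) {B : Set α} (hB : MeasurableSet B) (n : ℕ) {p : ℝ}
    (hp : p ≤ μ.real B) :
    P.real {ω | ∀ i : Fin n, Y i ω ∉ B} ≤ Real.exp (-(n * p)) := by
  have h1 : {ω | ∀ i : Fin n, Y i ω ∉ B} = ⋂ i ∈ Finset.range n, Y i ⁻¹' Bᶜ := by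
    ext ω
    simp [Fin.forall_iff]
  have h2 := hindep.measure_inter_preimage_eq_mul (Finset.range n) (sets := fun _ => Bᶜ)
    (fun _ _ => hB.compl)
  have h3 : ∀ i, P (Y i ⁻¹' Bᶜ) = μ Bᶜ := fun i => by
    rw [← (hlaw i).map_eq, Measure.map_apply_of_aemeasurable (hlaw i).aemeasurable hB.compl]
  have h4 : μ.real Bᶜ ≤ Real.exp (-p) := by
    rw [probReal_compl_eq_one_sub hB]
    have := Real.add_one_le_exp (-p)
    linarith
  rw [h1, measureReal_def, h2]
  simp only [h3, Finset.prod_const, Finset.card_range, ENNReal.toReal_pow]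
  rw [← mul_neg, Real.exp_nat_mul]
  exact pow_le_pow_left₀ ENNReal.toReal_nonneg h4 n

lemma measureReal_exists_forall_notMem_le {μ : Measure (Space d)}
    [IsProbabilityMeasure μ] {Y : ℕ → Ω → Space d} (hlaw : ∀ i, HasLaw (Y i) μ P)
    (hindep : iIndepFun Y P) (N : Finset (Space d)) (n : ℕ) {p r : ℝ}
    (hp : ∀ y ∈ N, p ≤ μ.real (Metric.closedBall y r)) :
    P.real {ω | ∃ y ∈ N, ∀ i : Fin n, Y i ω ∉ Metric.closedBall y r} ≤
      N.card * Real.exp (-(n * p)) := by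
  have h1 : {ω | ∃ y ∈ N, ∀ i : Fin n, Y i ω ∉ Metric.closedBall y r} =
      ⋃ y ∈ N, {ω | ∀ i : Fin n, Y i ω ∉ Metric.closedBall y r} := by
    ext ω; simp
  rw [h1]
  refine (measureReal_biUnion_finset_le _ _).trans ?_
  refine (Finset.sum_le_card_nsmul N _ _ fun y hy =>
    measureReal_forall_notMem_le hlaw hindep measurableSet_closedBall n (hp y hy)).trans ?_
  rw [nsmul_eq_mul]

lemma tendsto_log_div_nat : Tendsto (fun n : ℕ => Real.log n / n) atTop (𝓝 0) :=
  (Real.isLittleO_log_id_atTop.tendsto_div_nhds_zero).comp tendsto_natCast_atTop_atTop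

lemma tendsto_log_div_rpow (hd : d ≠ 0) :
    Tendsto (fun n : ℕ => (Real.log n / n) ^ (1 / (d : ℝ))) atTop (𝓝 0) := by
  have hd' : 0 < 1 / (d : ℝ) := by positivity
  have := tendsto_log_div_nat.rpow_const (p := 1 / (d : ℝ)) (Or.inr hd'.le)
  rwa [Real.zero_rpow hd'.ne'] at this

lemma tendsto_radius (hd : d ≠ 0) (c : ℝ) : Tendsto (radius d c) atTop (𝓝 0) := by
  have := (tendsto_log_div_rpow hd).const_mul c
  rwa [mul_zero] at this

lemma radius_pow (hd : d ≠ 0) (c : ℝ) (n : ℕ) :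
    radius d c n ^ d = c ^ d * (Real.log n / n) := by
  have h0 : 0 ≤ Real.log n / n := div_nonneg (Real.log_natCast_nonneg n) (Nat.cast_nonneg n)
  rw [radius, mul_pow, ← Real.rpow_natCast ((Real.log n / n) ^ _), ← Real.rpow_mul h0,
    one_div_mul_cancel (by exact_mod_cast hd), Real.rpow_one]

lemma radius_pos {c : ℝ} (hc : 0 < c) {n : ℕ} (hn : 2 ≤ n) : 0 < radius d c n := by
  have h1 : 0 < Real.log n := Real.log_pos (by exact_mod_cast hn)
  have h2 : (0 : ℝ) < n := by positivity
  exact mul_pos hc (Real.rpow_pos_of_pos (div_pos h1 h2) _)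

/-- Probability that the sample is not a net of the support, for a fixed sample size. -/
lemma measureReal_not_cover_le [IsProbabilityMeasure P]
    {M : Set (Space d)} {R D δ r p : ℝ} (hD : 0 ≤ D) (hMD : ∀ x, Metric.infDist x M ≤ R → ‖x‖ ≤ D)
    {μ : Measure (Space d)} [IsProbabilityMeasure μ]
    {Y : ℕ → Ω → Space d} (hlaw : ∀ i, HasLaw (Y i) μ P) (hindep : iIndepFun Y P) (n : ℕ)
    (hδ : 0 < δ) (hr : 0 < r)
    (hp : ∀ y, Metric.infDist y M ≤ R → p ≤ μ.real (Metric.closedBall y ((1 - δ) * r))) :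
    P.real {ω | ¬ ∀ y, Metric.infDist y M ≤ R → ∃ i : Fin n, dist y (Y i ω) ≤ r} ≤
      (D + δ * r / 2) ^ d / (δ * r / 2) ^ d * Real.exp (-(n * p)) := by
  -- A net at scale `δr` leaves `(1 - δ)r` for the distance from a net point to the sample.
  obtain ⟨N, hNS, hcov, hcard⟩ := exists_finset_net (S := {x | Metric.infDist x M ≤ R}) hD
    (mul_pos hδ hr) hMD
  rw [← le_div_iff₀ (by positivity)] at hcard
  refine le_trans (measureReal_mono ?_) ((measureReal_exists_forall_notMem_le hlaw hindep N n
    (fun y hy => hp y (hNS hy))).trans (by gcongr))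
  intro ω hω
  by_contra hcon
  refine hω fun x hx => ?_
  obtain ⟨y, hy, hxy⟩ := hcov x hx
  have : ∃ i : Fin n, Y i ω ∈ Metric.closedBall y ((1 - δ) * r) := by
    by_contra! hno
    exact hcon ⟨y, hy, hno⟩
  obtain ⟨i, hi⟩ := this
  refine ⟨i, ?_⟩
  have h1 : dist (Y i ω) y ≤ (1 - δ) * r := hi
  have h2 := dist_triangle x y (Y i ω)
  rw [dist_comm y] at h2
  linarith

/-- The first Borel-Cantelli lemma for bounds that hold eventually. -/
lemma ae_eventually_of_measureReal_not_le [IsFiniteMeasure P] {p : ℕ → Ω → Prop} {g : ℕ → ℝ}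
    (hg : Summable g) (h : ∀ᶠ n in atTop, P.real {ω | ¬ p n ω} ≤ g n) :
    ∀ᵐ ω ∂P, ∀ᶠ n in atTop, p n ω := by
  obtain ⟨n₀, hn₀⟩ := eventually_atTop.1 h
  have hsum : ∑' n, P {ω | ¬ p (n + n₀) ω} ≠ ⊤ := by
    refine ne_top_of_le_ne_top (((summable_nat_add_iff n₀).2 hg).tsum_ofReal_ne_top)
      (ENNReal.tsum_le_tsum fun n => ?_)
    rw [← ofReal_measureReal]
    exact ENNReal.ofReal_le_ofReal (hn₀ _ (Nat.le_add_left _ _))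
  filter_upwards [ae_eventually_notMem hsum] with ω hω
  filter_upwards [(tendsto_sub_atTop_nat n₀).eventually hω, eventually_ge_atTop n₀] with n hn hle
  rw [Nat.sub_add_cancel hle] at hn
  exact not_not.1 hn

/-- Almost surely the sample is eventually a net of the support at the scale of the radius. -/
lemma ae_eventually_cover [IsProbabilityMeasure P] (hd : d ≠ 0)
    {M : Set (Space d)} (hM : IsCompact M) (hne : M.Nonempty) {R : ℝ} (hR : 0 < R)
    {μ : Measure (Space d)} [IsProbabilityMeasure μ] {f₀ : ℝ} (hf₀ : 0 < f₀)
    (hdens : ∀ᵐ y ∂(volume.restrict (Metric.cthickening R M)),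
      ENNReal.ofReal f₀ ≤ μ.rnDeriv volume y)
    {Y : ℕ → Ω → Space d} (hlaw : ∀ i, HasLaw (Y i) μ P) (hindep : iIndepFun Y P)
    {c : ℝ} (hc0 : 0 < c) (hc : 6 < f₀ * unitBallVol d * c ^ d) :
    ∀ᵐ ω ∂P, ∀ᶠ n : ℕ in atTop, ∀ y, Metric.infDist y M ≤ R →
      ∃ i : Fin n, dist y (Y i ω) ≤ radius d c n := by
  -- One factor `1 - δ` pays for the net, the other for the volume loss `1 - r/(2R)`. The constant
  -- 5, halved, gives failure probability of order `n · n^(-5/2)`, which is summable.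
  obtain ⟨δ, hδ0, hδ1, hδ⟩ : ∃ δ : ℝ, 0 < δ ∧ δ < 1 ∧
      5 < f₀ * unitBallVol d * c ^ d * ((1 - δ) * (1 - δ)) ^ d := by
    have hcont : Tendsto (fun δ : ℝ => f₀ * unitBallVol d * c ^ d * ((1 - δ) * (1 - δ)) ^ d)
        (𝓝[>] 0) (𝓝 (f₀ * unitBallVol d * c ^ d * ((1 - 0) * (1 - 0)) ^ d)) :=
      (Continuous.tendsto (by fun_prop) 0).mono_left nhdsWithin_le_nhds
    have h5 := hcont.eventually_const_lt (u := 5) (by simp; linarith)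
    obtain ⟨δ, h1, h2⟩ := (h5.and (Ioo_mem_nhdsGT (zero_lt_one (α := ℝ)))).exists
    exact ⟨δ, h2.1, h2.2, h1⟩
  obtain ⟨D, hD0, hD⟩ : ∃ D : ℝ, 0 ≤ D ∧ ∀ x, Metric.infDist x M ≤ R → ‖x‖ ≤ D := by
    obtain ⟨D, hD⟩ := (hM.isBounded.cthickening (δ := R)).exists_norm_le
    refine ⟨max D 0, le_max_right _ _, fun x hx => (hD x ?_).trans (le_max_left _ _)⟩
    exact (mem_cthickening_iff_infDist_le hne hR.le).2 hx
  set K := (D + 1) ^ d / ((δ / 2) ^ d * c ^ d) with hK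
  have hK0 : 0 ≤ K := by positivity
  refine ae_eventually_of_measureReal_not_le (g := fun n : ℕ => K * (1 / (n : ℝ) ^ (3 / 2 : ℝ)))
    ((Real.summable_one_div_nat_rpow.2 (by norm_num)).mul_left K) ?_
  have hrad := tendsto_radius hd c
  filter_upwards [eventually_ge_atTop 3, hrad.eventually_lt_const (u := 1) one_pos,
    hrad.eventually_lt_const (u := R) hR,
    hrad.eventually_lt_const (u := 2 * R * δ) (by positivity)] with n hn h1 hrR ht
  set r := radius d c n with hr
  have hr0 : 0 < r := radius_pos hc0 (by omega)
  have hn0 : (0 : ℝ) < n := by positivity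
  -- Turns the net cardinality `O(n / log n)` into `O(n)`.
  have hlog : 1 ≤ Real.log n := by
    rw [Real.le_log_iff_exp_le hn0]
    have : (3 : ℝ) ≤ n := by exact_mod_cast hn
    linarith [Real.exp_one_lt_d9]
  have hδ1' : 0 < 1 - δ := by linarith
  have hp : ∀ y, Metric.infDist y M ≤ R →
      5 / 2 * (Real.log n / n) ≤ μ.real (Metric.closedBall y ((1 - δ) * r)) := by
    intro y hy
    have hle : (1 - δ) * r ≤ r := by nlinarith
    refine le_trans ?_ (measureReal_closedBall_ge hd hM hne hf₀.le hdens hy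
      (mul_pos hδ1' hr0) (hle.trans hrR.le))
    have ht' : (1 - δ) * r / (2 * R) ≤ δ := by
      rw [div_le_iff₀ (by positivity)]
      linarith
    have hω := unitBallVol_pos (d := d)
    calc 5 / 2 * (Real.log n / n)
        ≤ f₀ * unitBallVol d * c ^ d * ((1 - δ) * (1 - δ)) ^ d / 2 * (Real.log n / n) := by
          gcongr
      _ = f₀ * (unitBallVol d * ((1 - δ) * r * (1 - δ)) ^ d / 2) := by
          have : ((1 - δ) * r * (1 - δ)) ^ d = ((1 - δ) * (1 - δ)) ^ d * r ^ d := by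
            rw [← mul_pow]; ring
          rw [this, hr, radius_pow hd]; ring
      _ ≤ _ := by gcongr
  refine (measureReal_not_cover_le hD0 hD hlaw hindep n hδ0 hr0 hp).trans ?_
  have h2 : (D + δ * r / 2) ^ d / (δ * r / 2) ^ d ≤ K * n := by
    have h3 : (δ * r / 2) ^ d = (δ / 2) ^ d * c ^ d * (Real.log n / n) := by
      rw [mul_assoc, ← radius_pow hd, ← mul_pow]; congr 1; ring
    rw [h3, hK, div_mul_eq_mul_div, div_le_div_iff₀ (by positivity) (by positivity)]
    have h4 : (D + δ * r / 2) ^ d ≤ (D + 1) ^ d := by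
      gcongr
      nlinarith
    have h5 : (D + 1) ^ d * n * ((δ / 2) ^ d * c ^ d * (Real.log n / n)) =
        (D + 1) ^ d * ((δ / 2) ^ d * c ^ d) * Real.log n := by
      field_simp
    rw [h5]
    have h6 : 0 ≤ (δ / 2) ^ d * c ^ d := by positivity
    calc (D + δ * r / 2) ^ d * ((δ / 2) ^ d * c ^ d)
        ≤ (D + 1) ^ d * ((δ / 2) ^ d * c ^ d) * 1 := by rw [mul_one]; gcongr
      _ ≤ _ := by gcongr
  have h7 : Real.exp (-(n * (5 / 2 * (Real.log n / n)))) = (n : ℝ) ^ (-(5 / 2) : ℝ) := by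
    rw [Real.rpow_def_of_pos hn0]
    congr 1
    field_simp
  calc (D + δ * r / 2) ^ d / (δ * r / 2) ^ d * Real.exp (-(n * (5 / 2 * (Real.log n / n))))
      ≤ K * n * (n : ℝ) ^ (-(5 / 2) : ℝ) := by rw [h7]; gcongr
    _ = K * (1 / (n : ℝ) ^ (3 / 2 : ℝ)) := by
        rw [mul_assoc, one_div, ← Real.rpow_neg hn0.le]
        nth_rewrite 1 [← Real.rpow_one (n : ℝ)]
        rw [← Real.rpow_add hn0]
        norm_num

end Denoise

/-! ### Assembly of the covering and the deterministic bound. -/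

theorem mainTheorem6 {d : ℕ} {Ω : Type*} [MeasurableSpace Ω]
    (P : Measure Ω) [IsProbabilityMeasure P]
    (M : Set (Denoise.Space d)) (hM : IsCompact M) (hMint : interior M = ∅)
    (R₁ : ℝ) (hR₁ : 0 < R₁) (hreach : ENNReal.ofReal R₁ < Denoise.reach M)
    (μ : Measure (Denoise.Space d)) [IsProbabilityMeasure μ]
    (hsupp : μ.support = Metric.cthickening R₁ M)
    (hac : μ ≪ volume)
    (f₀ : ℝ) (hf₀ : 0 < f₀)
    (hdens : ∀ᵐ y ∂(volume.restrict (Metric.cthickening R₁ M)),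
      ENNReal.ofReal f₀ ≤ μ.rnDeriv volume y)
    (Y : ℕ → Ω → Denoise.Space d) (hlaw : ∀ i, HasLaw (Y i) μ P) (hindep : iIndepFun Y P)
    (c : ℝ) (hc : (6 / (f₀ * Denoise.unitBallVol d)) ^ (1 / (d : ℝ)) < c)
    (lam : ℝ) (hlam₀ : 0 < lam) (hlam₁ : lam < 1) :
    ∃ C : ℝ, ∀ᵐ ω ∂P, ∀ᶠ n : ℕ in atTop,
      (Denoise.denoisedSample lam (Denoise.radius d c n) (fun i : Fin n => Y i ω)).Nonempty ∧
      Metric.hausdorffDist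
          (Denoise.denoisedSample lam (Denoise.radius d c n) (fun i : Fin n => Y i ω)) M
        ≤ C * (Real.log n / n) ^ (1 / (3 * (d : ℝ))) := by
  have hne : M.Nonempty := by
    by_contra h
    rw [Set.not_nonempty_iff_eq_empty.1 h, Metric.cthickening_empty,
      Measure.support_eq_empty_iff] at hsupp
    exact IsProbabilityMeasure.ne_zero μ hsupp
  have hd : d ≠ 0 := by
    rintro rfl
    have h : M = Set.univ := Subsingleton.eq_univ_of_nonempty hne
    rw [h, interior_univ] at hMint
    exact (Set.univ_nonempty (α := Denoise.Space 0)).ne_empty hMint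
  have hq : 0 ≤ 6 / (f₀ * Denoise.unitBallVol d) := by
    have := Denoise.unitBallVol_pos (d := d)
    positivity
  have hc0 : 0 < c := lt_of_le_of_lt (Real.rpow_nonneg hq _) hc
  have hc6 : 6 < f₀ * Denoise.unitBallVol d * c ^ d := by
    have h1 := pow_lt_pow_left₀ hc (Real.rpow_nonneg hq _) hd
    rw [← Real.rpow_natCast (_ ^ _), ← Real.rpow_mul hq,
      one_div_mul_cancel (by exact_mod_cast hd), Real.rpow_one,
      div_lt_iff₀ (mul_pos hf₀ Denoise.unitBallVol_pos)] at h1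
    linarith
  -- Room above `R₁` keeps the level `R₁ + 2r` inside the reach.
  obtain ⟨R₂, hR₂, hR₂'⟩ : ∃ R₂ : ℝ, R₁ < R₂ ∧ ENNReal.ofReal R₂ < Denoise.reach M := by
    have hcont : Tendsto ENNReal.ofReal (𝓝[>] R₁) (𝓝 (ENNReal.ofReal R₁)) :=
      (ENNReal.continuous_ofReal.tendsto R₁).mono_left nhdsWithin_le_nhds
    obtain ⟨R₂, h1, h2⟩ := ((hcont.eventually_lt_const hreach).and self_mem_nhdsWithin).exists
    exact ⟨R₂, h2, h1⟩
  have hmem : ∀ᵐ ω ∂P, ∀ i, Metric.infDist (Y i ω) M ≤ R₁ := by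
    rw [ae_all_iff]
    intro i
    have h1 : ∀ᵐ y ∂(P.map (Y i)), y ∈ μ.support := by
      rw [(hlaw i).map_eq]; exact Measure.support_mem_ae
    filter_upwards [ae_of_ae_map (hlaw i).aemeasurable h1] with ω hω
    rw [hsupp] at hω
    exact (Denoise.mem_cthickening_iff_infDist_le hne hR₁.le).1 hω
  have hcover := Denoise.ae_eventually_cover hd hM hne hR₁ hf₀ hdens hlaw hindep hc0 hc6
  refine ⟨√(30 * R₁ / lam * c) + 8 * c, ?_⟩
  filter_upwards [hmem, hcover] with ω hω1 hω2
  have hrad := Denoise.tendsto_radius hd c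
  filter_upwards [hω2, eventually_ge_atTop 2,
    hrad.eventually_lt_const (u := R₁ / 4) (by positivity),
    hrad.eventually_lt_const (u := (R₂ - R₁) / 2) (by linarith),
    -- Since `4 lam + 2 < 6`, this yields `lam (R₁ + 4r) < R₁ - 2r`.
    hrad.eventually_lt_const (u := (1 - lam) * R₁ / 6) (by
      have := mul_pos (sub_pos.2 hlam₁) hR₁
      linarith),
    (Denoise.tendsto_log_div_rpow hd).eventually_lt_const (u := 1) one_pos]
    with n hcov hn h1 h2 h3 h4
  have hr := Denoise.radius_pos (d := d) hc0 hn
  obtain ⟨hN, hH⟩ := Denoise.hausdorffDist_denoisedSample_le hM hne hMint hr (by linarith)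
    hlam₀ (by nlinarith)
    (lt_of_le_of_lt (ENNReal.ofReal_le_ofReal (by linarith)) hR₂')
    (x := fun i : Fin n => Y i ω) (fun i => hω1 i) hcov
  refine ⟨hN, hH.trans ?_⟩
  have hlog : 0 ≤ Real.log n / n := div_nonneg (Real.log_natCast_nonneg n) (Nat.cast_nonneg n)
  set ρ := (Real.log n / n) ^ (1 / (d : ℝ)) with hρ
  have hρ0 : 0 ≤ ρ := Real.rpow_nonneg hlog _
  have hpow : (Real.log n / n) ^ (1 / (3 * (d : ℝ))) = ρ ^ (1 / 3 : ℝ) := by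
    rw [hρ, ← Real.rpow_mul hlog]
    congr 1
    field_simp
  have hpos : 0 < ρ := by
    have : 0 < c * ρ := hr
    exact pos_of_mul_pos_right this hc0.le
  -- The exponent weakens from 1/2 to 1/3 because `ρ < 1`.
  have h5 : √ρ ≤ ρ ^ (1 / 3 : ℝ) := by
    rw [Real.sqrt_eq_rpow]
    exact Real.rpow_le_rpow_of_exponent_ge hpos h4.le (by norm_num)
  have h6 : ρ ≤ ρ ^ (1 / 3 : ℝ) := by
    conv_lhs => rw [← Real.rpow_one ρ]
    exact Real.rpow_le_rpow_of_exponent_ge hpos h4.le (by norm_num)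
  have h7 : Denoise.radius d c n = c * ρ := rfl
  rw [hpow, h7, ← mul_assoc (30 * R₁ / lam), Real.sqrt_mul (by positivity), add_mul]
  rw [mul_assoc 8]
  gcongr
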